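/- Let $\Sigma$ be a finite alphabet and $(\mathbb{D},+,0)$ a commutative monoid. A \emph{cost function} is a partial function $f:\Sigma^*\to\mathbb{D}$; write $f(\sigma)=\bot$ if $f$ is undefined at $\sigma$. A \emph{copyless cost register automaton} has a finite set $Q$ of states, a finite set $V$ of registers, a transition function $\delta:Q\times\Sigma\to Q$, an update function $\mu:Q\times\Sigma\times V\to(V\cup\mathbb{D})^*$, an initial state $q_0\in Q$, a set $F\subseteq Q$ of final states and an output function $\nu:F\to(V\cup\mathbb{D})^*$ (here $V\cup\mathbb{D}$ is a disjoint union). It is required that for all $q,a$ each register occurs at most once in each word $\mu(q,a,u)$ and in at most one of the words $\mu(q,a,u)$, $u\in V$, and that each register occurs at most once in each word $\nu(q)$. All registers start at $0$; reading $a$ in state $q$ moves to $\delta(q,a)$ and simultaneously gives each register $u$ the value of the word $\mu(q,a,u)$ (the sum of its letters, registers being replaced by their old values). The automaton computes the cost function that sends $\sigma$ to the value of the word $\nu(q_f)$ under the final register values if the state $q_f$ reached on $\sigma$ is in $F$, and is undefined at $\sigma$ otherwise. A cost function is \emph{regular} if it is computed by some copyless cost register automaton. An \emph{additive} cost register automaton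 is defined in the same way, but with arbitrary $\mu:Q\times\Sigma\times V\to V\times\mathbb{D}$ and $\nu:F\to V\times\mathbb{D}$ and no copyless requirement, where the pair $(v,d)$ stands for the expression $v+d$. Consider the following operations on cost functions. \begin{itemize} \item \emph{Base functions}: for a regular language $L\subseteq\Sigma^*$ and $d\in\mathbb{D}$, the function with value $d$ on $L$ and undefined outside $L$. \item \emph{Choice} $f\vartriangleright g$: its value at $\sigma$ is $f(\sigma)$ if $f(\sigma)\ne\bot$, and $g(\sigma)$ otherwise. \item \emph{Split sum} $f\oplus g$: its value at $\sigma$ is $f(\sigma_1)+g(\sigma_2)$ if there is exactly one pair $(\sigma_1,\sigma_2)$ with $\sigma=\sigma_1\sigma_2$, $f(\sigma_1)\neq\bot$ and $g(\sigma_2)\ne\bot$; otherwise it is undefined at $\sigma$. \item \emph{Iterated sum} $\sum f$: its value at $\sigma$ is $f(\sigma_1)+\cdots+f(\sigma_k)$ if there is exactly one finite sequence $(\sigma_1,\dots,\sigma_k)$, $k\ge 0$, with $\sigma=\sigma_1\cdots\sigma_k$ and $f(\sigma_i)\neq\bot$ for all $i$; otherwise it is undefined at $\sigma$. \end{itemize}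 \textbf{Theorem.} Every regular cost function $f:\Sigma^*\to\mathbb{D}$ can be expressed using the base functions combined with the choice, split sum and iterated sum operators; that is, $f$ belongs to the least class of cost functions that contains the base functions and is closed under these three operators. The same holds for every cost function computed by an additive cost register automaton. -/

import Mathlib

namespace RegCost

/-- A cost function: a partial function from strings over `α` to `D`, written as a total function
into `D` with an added undefined value `⊥`.  Addition on `WithBot D` is absorbing at `⊥`. -/
abbrev CostFn (α D : Type*) := List α → WithBot D

section Combinators

variable {α D : Type*}

open Classical in
/-- The constant function: `d` on the language `L`, undefined elsewhere. -/
noncomputable def const (L : Language α) (d : D) : CostFn α D :=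
  fun σ => if σ ∈ L then (d : WithBot D) else ⊥

open Classical in
/-- Conditional choice: `f` where `f` is defined, and `g` elsewhere. -/
noncomputable def choice (f g : CostFn α D) : CostFn α D :=
  fun σ => if f σ ≠ ⊥ then f σ else g σ

/-- `p` splits `σ` into a part on which `f` is defined followed by a part on which `g` is. -/
def IsSplit (f g : CostFn α D) (σ : List α) (p : List α × List α) : Prop :=
  σ = p.1 ++ p.2 ∧ f p.1 ≠ ⊥ ∧ g p.2 ≠ ⊥

open Classical in
/-- Split sum: `f σ₁ + g σ₂` if there is exactly one split `σ = σ₁ σ₂` with both terms defined,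
and undefined otherwise. -/
noncomputable def splitSum [Add D] (f g : CostFn α D) : CostFn α D :=
  fun σ => if h : ∃! p, IsSplit f g σ p then f h.choose.1 + g h.choose.2 else ⊥

/-- `l = [σ₁, …, σₖ]` (with `k ≥ 0`) decomposes `σ` into parts on which `f` is defined. -/
def IsDecomposition (f : CostFn α D) (σ : List α) (l : List (List α)) : Prop :=
  σ = l.flatten ∧ ∀ τ ∈ l, f τ ≠ ⊥

open Classical in
/-- Iterated sum: `f σ₁ + ⋯ + f σₖ` if there is exactly one decomposition `σ = σ₁ ⋯ σₖ`
(the number `k ≥ 0` of parts included) with all terms defined, and undefined otherwise. -/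
noncomputable def iterSum [AddMonoid D] (f : CostFn α D) : CostFn α D :=
  fun σ => if h : ∃! l, IsDecomposition f σ l then (h.choose.map f).sum else ⊥

/-- The least class of cost functions that contains the base functions (the constant functions
with a regular domain) and is closed under choice, split sum and iterated sum. -/
inductive Expressible [AddMonoid D] : CostFn α D → Prop
  | const (L : Language α) (hL : L.IsRegular) (d : D) : Expressible (const L d)
  | choice {f g : CostFn α D} : Expressible f → Expressible g → Expressible (choice f g)
  | splitSum {f g : CostFn α D} : Expressible f → Expressible g → Expressible (splitSum f g)
  | iterSum {f : CostFn α D} : Expressible f → Expressible (iterSum f)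

end Combinators

section Copyless

variable {V D : Type*}

/-- The registers occurring in an expression, a word over `V ∪ D`, in order of occurrence and
with repetition. -/
def regs (e : List (V ⊕ D)) : List V := e.filterMap Sum.getLeft?

/-- An expression is copyless if each register occurs at most once in it. -/
def CopylessExpr (e : List (V ⊕ D)) : Prop := (regs e).Nodup

/-- A register update is copyless if each register occurs at most once in each right-hand side,
and no register occurs in two of them. -/
def CopylessUpdate (f : V → List (V ⊕ D)) : Prop :=
  (∀ u, CopylessExpr (f u)) ∧ ∀ u v w, u ≠ w → v ∈ regs (f u) → v ∉ regs (f w)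

/-- The value of an expression: registers are read off `val`, constants stand for themselves,
and the letters are added from left to right. -/
def exprVal [AddMonoid D] (val : V → D) (e : List (V ⊕ D)) : D :=
  (e.map (Sum.elim val id)).sum

end Copyless

/-- Copyless cost register automata with states `Q` and registers `V`. -/
structure CCRA (α D Q V : Type*) where
  /-- state transitions -/
  δ : Q → α → Q
  /-- register updates -/
  μ : Q → α → V → List (V ⊕ D)
  μ_copyless : ∀ q a, CopylessUpdate (μ q a)
  /-- initial state -/
  q₀ : Q
  /-- final states -/
  F : Set Q
  /-- output expressions -/
  ν : F → List (V ⊕ D)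
  ν_copyless : ∀ q, CopylessExpr (ν q)

namespace CCRA

variable {α D Q V : Type*} [AddMonoid D] (M : CCRA α D Q V)

/-- One step on configurations: a state and a register valuation. -/
def step (γ : Q × (V → D)) (a : α) : Q × (V → D) :=
  (M.δ γ.1 a, fun v => exprVal γ.2 (M.μ γ.1 a v))

/-- The configuration reached from the initial one (all registers `0`) on reading `σ`. -/
def run (σ : List α) : Q × (V → D) := σ.foldl M.step (M.q₀, fun _ => 0)

open Classical in
/-- The cost function computed by `M`. -/
noncomputable def eval : CostFn α D :=
  fun σ => if h : (M.run σ).1 ∈ M.F then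
    ((exprVal (M.run σ).2 (M.ν ⟨(M.run σ).1, h⟩) : D) : WithBot D) else ⊥

end CCRA

/-- Additive cost register automata with states `Q` and registers `V`: `μ q a u = (v, d)` stands
for the update `u := v + d`, and `ν q = (v, d)` for the output `v + d`. -/
structure ACRA (α D Q V : Type*) where
  /-- state transitions -/
  δ : Q → α → Q
  /-- register updates -/
  μ : Q → α → V → V × D
  /-- initial state -/
  q₀ : Q
  /-- final states -/
  F : Set Q
  /-- output function -/
  ν : F → V × D

namespace ACRA

variable {α D Q V : Type*} [AddMonoid D] (M : ACRA α D Q V)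

/-- One step on configurations: a state and a register valuation. -/
def step (γ : Q × (V → D)) (a : α) : Q × (V → D) :=
  (M.δ γ.1 a, fun u => γ.2 (M.μ γ.1 a u).1 + (M.μ γ.1 a u).2)

/-- The configuration reached from the initial one (all registers `0`) on reading `σ`. -/
def run (σ : List α) : Q × (V → D) := σ.foldl M.step (M.q₀, fun _ => 0)

open Classical in
/-- The cost function computed by `M`. -/
noncomputable def eval : CostFn α D :=
  fun σ => if h : (M.run σ).1 ∈ M.F then
    (((M.run σ).2 (M.ν ⟨(M.run σ).1, h⟩).1 + (M.ν ⟨(M.run σ).1, h⟩).2 : D) : WithBot D) else ⊥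

end ACRA

/-- A cost function is regular if it is computed by a copyless cost register automaton with
finitely many states and registers. -/
def IsRegular {α D : Type*} [AddMonoid D] (f : CostFn α D) : Prop :=
  ∃ (Q V : Type) (_ : Finite Q) (_ : Finite V) (M : CCRA α D Q V), M.eval = f

/-- `f` is computed by an additive cost register automaton with finitely many states and
registers. -/
def IsAdditiveRegular {α D : Type*} [AddMonoid D] (f : CostFn α D) : Prop :=
  ∃ (Q V : Type) (_ : Finite Q) (_ : Finite V) (M : ACRA α D Q V), M.eval = f

end RegCost

/-! The output is read backwards. In an additive automaton the output register has exactly one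
source register at each earlier time. In a copyless one the output draws on a set of registers;
their source sets are disjoint, so over a commutative monoid the sum over the set becomes the sum
over its sources plus constants. As registers start at `0`, the output is a sum of constants
collected along a run whose states pair the forward state with the tracked register or set
(`ACRA.foldl_step_snd`, `CCRA.sum_foldl_step`), plus an output constant. The forward component is
fixed by the left endpoint, the tracked one by the right endpoint, so endpoints and word determine
every intermediate state.

For such unambiguous paths, Kleene's state elimination works with the three operators: a path
allowed to visit `k` either avoids it or consists of a leg to the first visit, loops at `k` and a
final leg (`through_insert`, `through_insert_loops`). The cuts are the visits to `k`, which are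
determined by the word, so each sum sees exactly one decomposition. Keeping to nonempty words
excludes empty loops, which would destroy this uniqueness. -/

namespace RegCost

/-! ### Calculus of the combinators -/

section Combinators

variable {α D : Type*}

theorem isRegular_of_finite {L : Language α} (hL : Set.Finite (L : Set (List α))) :
    L.IsRegular := by
  refine .of_finite_range_leftQuotient ?_
  -- Every left quotient of `L` consists of suffixes of words of `L`.
  have hfin : (⋃ x ∈ (L : Set (List α)), {z | z ∈ x.tails}).Finite :=
    hL.biUnion fun x _ => x.tails.finite_toSet
  refine hfin.finite_subsets.subset ?_
  rintro _ ⟨y, rfl⟩ z hz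
  exact Set.mem_biUnion (x := y ++ z) hz (by simp)

theorem const_of_mem {L : Language α} {σ : List α} (d : D) (h : σ ∈ L) : const L d σ = d :=
  if_pos h

theorem const_of_notMem {L : Language α} {σ : List α} (d : D) (h : σ ∉ L) : const L d σ = ⊥ :=
  if_neg h

theorem const_singleton_self (σ : List α) (d : D) : const {σ} d σ = d :=
  const_of_mem d (Set.mem_singleton σ)

theorem const_singleton_ne_bot {σ τ : List α} {d : D} : const {τ} d σ ≠ ⊥ ↔ σ = τ := by
  refine ⟨fun h => ?_, ?_⟩
  · by_contra hne
    exact h (const_of_notMem d hne)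
  · rintro rfl
    simp [const_singleton_self]

theorem choice_of_ne_bot {f g : CostFn α D} {σ : List α} (h : f σ ≠ ⊥) : choice f g σ = f σ :=
  if_pos h

theorem choice_of_eq_bot {f g : CostFn α D} {σ : List α} (h : f σ = ⊥) : choice f g σ = g σ :=
  if_neg (not_not.2 h)

theorem splitSum_eq_add [Add D] {f g : CostFn α D} {σ : List α} {p : List α × List α}
    (hp : IsSplit f g σ p) (huniq : ∀ p', IsSplit f g σ p' → p' = p) :
    splitSum f g σ = f p.1 + g p.2 := by
  have h : ∃! p, IsSplit f g σ p := ⟨p, hp, huniq⟩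
  rw [splitSum, dif_pos h, huniq _ h.choose_spec.1]

theorem splitSum_eq_bot [Add D] {f g : CostFn α D} {σ : List α}
    (hp : ∀ p, ¬ IsSplit f g σ p) : splitSum f g σ = ⊥ :=
  dif_neg fun ⟨p, h, _⟩ => hp p h

theorem iterSum_eq_sum [AddMonoid D] {f : CostFn α D} {σ : List α} {l : List (List α)}
    (hl : IsDecomposition f σ l) (huniq : ∀ l', IsDecomposition f σ l' → l' = l) :
    iterSum f σ = (l.map f).sum := by
  have h : ∃! l, IsDecomposition f σ l := ⟨l, hl, huniq⟩
  rw [iterSum, dif_pos h, huniq _ h.choose_spec.1]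

theorem exists_isDecomposition [AddMonoid D] {f : CostFn α D} {σ : List α}
    (h : iterSum f σ ≠ ⊥) : ∃ l, IsDecomposition f σ l := by
  by_contra hn
  exact h (dif_neg fun hu => hn hu.exists)

theorem Expressible.bot [AddMonoid D] : Expressible (fun _ => ⊥ : CostFn α D) := by
  convert Expressible.const (⊥ : Language α) (isRegular_of_finite Set.finite_empty) (0 : D) using 1
  funext σ
  exact (const_of_notMem (L := ⊥) _ (Set.notMem_empty σ)).symm

/-- A cost function that is the union of finitely many expressible restrictions of it is
expressible. -/
theorem Expressible.of_pieces [AddMonoid D] {ι : Type*} [Finite ι] {f : CostFn α D}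
    (g : ι → CostFn α D) (hg : ∀ i, Expressible (g i)) (hgf : ∀ i σ, g i σ ≠ ⊥ → g i σ = f σ)
    (hfg : ∀ σ, f σ ≠ ⊥ → ∃ i, g i σ ≠ ⊥) : Expressible f := by
  classical
  -- All pieces agree with `f` where defined, so the order of the choices is immaterial.
  have key : ∀ s : Finset ι, ∃ h : CostFn α D, Expressible h ∧ (∀ σ, h σ ≠ ⊥ → h σ = f σ) ∧
      ∀ i ∈ s, ∀ σ, g i σ ≠ ⊥ → h σ ≠ ⊥ := by
    intro s
    induction s using Finset.induction_on with
    | empty => exact ⟨_, .bot, by simp, by simp⟩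
    | insert a s _ ih =>
      obtain ⟨h, hh, h1, h2⟩ := ih
      refine ⟨_, .choice (hg a) hh, fun σ => ?_, fun i hi σ hσ => ?_⟩
      · by_cases ha : g a σ = ⊥
        · rw [choice_of_eq_bot ha]; exact h1 σ
        · rw [choice_of_ne_bot ha]; exact hgf a σ
      · by_cases ha : g a σ = ⊥
        · rw [choice_of_eq_bot ha]
          rcases Finset.mem_insert.1 hi with rfl | hi
          · exact absurd ha hσ
          · exact h2 i hi σ hσ
        · rwa [choice_of_ne_bot ha]
  have := Fintype.ofFinite ι
  obtain ⟨h, hh, h1, h2⟩ := key Finset.univ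
  convert hh using 1
  funext σ
  by_cases hσ : h σ = ⊥
  · by_contra hne
    obtain ⟨i, hi⟩ := hfg σ fun hf => hne (hf.trans hσ.symm)
    exact h2 i (Finset.mem_univ i) σ hi hσ
  · exact (h1 σ hσ).symm

end Combinators

/-! ### State elimination for unambiguous paths -/

/-- Weighted connections between states by words in which the state at each intermediate position
is determined by the endpoints and the word. -/
structure PathSystem (α D S : Type*) [AddMonoid D] where
  /-- `Rel i w j`: some path labelled `w` leads from `i` to `j` -/
  Rel : S → List α → S → Prop
  /-- the weight of that path -/
  wt : S → List α → S → D
  rel_nil : ∀ {i j}, Rel i [] j ↔ i = j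
  rel_append : ∀ {i j u v}, Rel i (u ++ v) j ↔ ∃ k, Rel i u k ∧ Rel k v j
  mid_unique : ∀ {i j u v k k'}, Rel i u k → Rel k v j → Rel i u k' → Rel k' v j → k = k'
  wt_nil : ∀ i, wt i [] i = 0
  wt_append : ∀ {i j u v k}, Rel i u k → Rel k v j → wt i (u ++ v) j = wt i u k + wt k v j

namespace PathSystem

variable {α D S : Type*} [AddMonoid D] (T : PathSystem α D S)

/-- A nonempty path labelled `w` leads from `i` to `j` with all intermediate states in `K`. -/
def Dom (K : Set S) (i j : S) (w : List α) : Prop :=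
  w ≠ [] ∧ T.Rel i w j ∧
    ∀ u v k, u ++ v = w → u ≠ [] → v ≠ [] → T.Rel i u k → T.Rel k v j → k ∈ K

open Classical in
/-- The weights of the nonempty paths from `i` to `j` with all intermediate states in `K`. -/
noncomputable def through (K : Set S) (i j : S) : CostFn α D :=
  fun w => if T.Dom K i j w then (T.wt i w j : WithBot D) else ⊥

variable {T} {K : Set S} {i j k : S} {u v w : List α}

theorem through_of_dom (h : T.Dom K i j w) : T.through K i j w = T.wt i w j := if_pos h

theorem through_of_not_dom (h : ¬ T.Dom K i j w) : T.through K i j w = ⊥ := if_neg h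

theorem through_ne_bot : T.through K i j w ≠ ⊥ ↔ T.Dom K i j w := by
  by_cases h : T.Dom K i j w
  · simp [through_of_dom h, h]
  · simp [through_of_not_dom h, h]

theorem Dom.mono {K' : Set S} (h : T.Dom K i j w) (hK : K ⊆ K') : T.Dom K' i j w :=
  ⟨h.1, h.2.1, fun u v m e hu hv h1 h2 => hK (h.2.2 u v m e hu hv h1 h2)⟩

theorem Rel.append (hu : T.Rel i u k) (hv : T.Rel k v j) : T.Rel i (u ++ v) j :=
  T.rel_append.2 ⟨k, hu, hv⟩

/-- The path through `m` also has a middle state at the cut before `v`, and `mid_unique` identifies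
it with `k`. -/
theorem rel_left_of_append {x : List α} (h1 : T.Rel i (u ++ x) k) (h2 : T.Rel k v j) {m : S}
    (hm : T.Rel i u m) (hm' : T.Rel m (x ++ v) j) : T.Rel m x k := by
  obtain ⟨n, hn, hn'⟩ := T.rel_append.1 hm'
  rwa [T.mid_unique h1 h2 (hm.append hn) hn']

theorem rel_right_of_append {x : List α} (h1 : T.Rel i u k) (h2 : T.Rel k (x ++ v) j) {m : S}
    (hm : T.Rel i (u ++ x) m) (hm' : T.Rel m v j) : T.Rel k x m := by
  obtain ⟨n, hn, hn'⟩ := T.rel_append.1 h2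
  rwa [T.mid_unique hm hm' (h1.append hn) hn']

theorem Dom.append (hu : T.Dom K i k u) (hv : T.Dom K k j v) (hk : k ∈ K) :
    T.Dom K i j (u ++ v) := by
  refine ⟨by simp [hu.1], hu.2.1.append hv.2.1, fun a b m e ha hb hm hm' => ?_⟩
  rcases List.append_eq_append_iff.1 e with ⟨x, rfl, rfl⟩ | ⟨x, rfl, rfl⟩
  · rcases eq_or_ne x [] with rfl | hx
    · rw [List.append_nil] at hu
      rwa [T.mid_unique hm hm' hu.2.1 hv.2.1]
    · exact hu.2.2 a x m rfl ha hx hm (rel_left_of_append hu.2.1 hv.2.1 hm hm')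
  · rcases eq_or_ne x [] with rfl | hx
    · rw [List.append_nil] at hm
      rwa [T.mid_unique hm hm' hu.2.1 hv.2.1]
    · exact hv.2.2 x b m rfl hx hb (rel_right_of_append hu.2.1 hv.2.1 hm hm') hm'

theorem Dom.left (h : T.Dom K i j (u ++ v)) (hu : u ≠ []) (h1 : T.Rel i u k)
    (h2 : T.Rel k v j) : T.Dom K i k u := by
  refine ⟨hu, h1, ?_⟩
  rintro a b m rfl ha hb hm hm'
  exact h.2.2 a (b ++ v) m (by simp) ha (by simp [hb]) hm (hm'.append h2)

theorem Dom.right (h : T.Dom K i j (u ++ v)) (hv : v ≠ []) (h1 : T.Rel i u k)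
    (h2 : T.Rel k v j) : T.Dom K k j v := by
  refine ⟨hv, h2, ?_⟩
  rintro a b m rfl ha hb hm hm'
  exact h.2.2 (u ++ a) b m (by simp) (by simp [ha]) hb (h1.append hm) hm'

/-- A path through `insert k K` but not through `K` visits `k`. -/
theorem Dom.exists_visit (h : T.Dom (insert k K) i j w) (hn : ¬ T.Dom K i j w) :
    ∃ u v, u ++ v = w ∧ u ≠ [] ∧ v ≠ [] ∧ T.Rel i u k ∧ T.Rel k v j := by
  by_contra hc
  refine hn ⟨h.1, h.2.1, fun u v m e hu hv h1 h2 => ?_⟩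
  rcases h.2.2 u v m e hu hv h1 h2 with rfl | hm
  · exact absurd ⟨u, v, e, hu, hv, h1, h2⟩ hc
  · exact hm

/-- A path that visits `k` splits at its first visit. -/
theorem Dom.exists_first (h : T.Dom (insert k K) i j w) (hn : ¬ T.Dom K i j w) :
    ∃ u v, w = u ++ v ∧ T.Dom K i k u ∧ T.Dom (insert k K) k j v := by
  induction hl : w.length using Nat.strong_induction_on generalizing w j with
  | _ n ih =>
    obtain ⟨u, v, rfl, hu, hv, h1, h2⟩ := h.exists_visit hn
    -- The visit found need not be the first; if `u` contains an earlier one, recurse on the shorter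
    -- word `u`.
    by_cases hk : T.Dom K i k u
    · exact ⟨u, v, rfl, hk, h.right hv h1 h2⟩
    · have hlt : u.length < n := by
        have := List.length_pos_of_ne_nil hv
        rw [← hl, List.length_append]; omega
      obtain ⟨a, b, rfl, ha, hb⟩ := ih _ hlt (h.left hu h1 h2) hk rfl
      exact ⟨a, b ++ v, by simp, ha, hb.append (h.right hv h1 h2) (Set.mem_insert _ _)⟩

/-- A path that starts at `k` splits at all its visits to `k`. -/
theorem Dom.exists_loops (h : T.Dom (insert k K) k j w) :
    ∃ (l : List (List α)) (v : List α), w = l.flatten ++ v ∧ (∀ τ ∈ l, T.Dom K k k τ) ∧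
      T.Dom K k j v := by
  induction hl : w.length using Nat.strong_induction_on generalizing w j with
  | _ n ih =>
    by_cases hn : T.Dom K k j w
    · exact ⟨[], w, by simp, by simp, hn⟩
    · obtain ⟨u, v, rfl, hu, hv⟩ := h.exists_first hn
      have hlt : v.length < n := by
        have := List.length_pos_of_ne_nil hu.1
        rw [← hl, List.length_append]; omega
      obtain ⟨l, v, rfl, hl', hv'⟩ := ih _ hlt hv rfl
      exact ⟨u :: l, v, by simp, by simpa using ⟨hu, hl'⟩, hv'⟩

/-- If two cuts differed, the shorter prefix would end in a visit to `k` strictly inside the longer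
one, which `k ∉ K` forbids. -/
theorem first_unique {u' v' : List α} (hk : k ∉ K) (e : u ++ v = u' ++ v')
    (hu : T.Dom K i k u) (hv : T.Rel k v j) (hu' : T.Dom K i k u') (hv' : T.Rel k v' j) :
    u = u' ∧ v = v' := by
  have aux : ∀ {u v x : List α}, T.Dom K i k u → T.Rel k (x ++ v) j → T.Dom K i k (u ++ x) →
      T.Rel k v j → x = [] := by
    intro u v x h1 h2 h3 h4
    by_contra hx
    exact hk (h3.2.2 u x k rfl h1.1 hx h1.2.1 (rel_left_of_append h3.2.1 h4 h1.2.1 h2))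
  rcases List.append_eq_append_iff.1 e with ⟨x, rfl, rfl⟩ | ⟨x, rfl, rfl⟩
  · simp [aux hu hv hu' hv']
  · simp [aux hu' hv' hu hv]

theorem last_unique {u' v' : List α} (hk : k ∉ K) (e : u ++ v = u' ++ v')
    (hu : T.Rel i u k) (hv : T.Dom K k j v) (hu' : T.Rel i u' k) (hv' : T.Dom K k j v') :
    u = u' ∧ v = v' := by
  have aux : ∀ {u v x : List α}, T.Rel i u k → T.Dom K k j (x ++ v) → T.Rel i (u ++ x) k →
      T.Dom K k j v → x = [] := by
    intro u v x h1 h2 h3 h4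
    by_contra hx
    exact hk (h2.2.2 x v k rfl hx h4.1 (rel_right_of_append h1 h2.2.1 h3 h4.2.1) h4.2.1)
  rcases List.append_eq_append_iff.1 e with ⟨x, rfl, rfl⟩ | ⟨x, rfl, rfl⟩
  · simp [aux hu hv hu' hv']
  · simp [aux hu' hv' hu hv]

theorem rel_flatten {l : List (List α)} (h : ∀ τ ∈ l, T.Dom K k k τ) : T.Rel k l.flatten k := by
  induction l with
  | nil => exact T.rel_nil.2 rfl
  | cons τ l ih =>
    rw [List.forall_mem_cons] at h
    exact h.1.2.1.append (ih h.2)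

theorem dom_flatten_append {l : List (List α)} (h : ∀ τ ∈ l, T.Dom K k k τ)
    (hv : T.Dom K k j v) : T.Dom (insert k K) k j (l.flatten ++ v) := by
  induction l with
  | nil => exact hv.mono (Set.subset_insert _ _)
  | cons τ l ih =>
    rw [List.forall_mem_cons] at h
    rw [List.flatten_cons, List.append_assoc]
    exact (h.1.mono (Set.subset_insert _ _)).append (ih h.2) (Set.mem_insert _ _)

/-- Loops are peeled off by `first_unique`; their nonemptiness rules out lists of different length.
-/
theorem flatten_injective (hk : k ∉ K) {l l' : List (List α)} (h : ∀ τ ∈ l, T.Dom K k k τ)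
    (h' : ∀ τ ∈ l', T.Dom K k k τ) (e : l.flatten = l'.flatten) : l = l' := by
  induction l generalizing l' with
  | nil =>
    cases l' with
    | nil => rfl
    | cons τ l' =>
      rw [List.forall_mem_cons] at h'
      exact absurd (List.append_eq_nil_iff.1 e.symm).1 h'.1.1
  | cons τ l ih =>
    rw [List.forall_mem_cons] at h
    cases l' with
    | nil => exact absurd (List.append_eq_nil_iff.1 e).1 h.1.1
    | cons τ' l' =>
      rw [List.forall_mem_cons] at h'
      obtain ⟨rfl, e'⟩ := first_unique hk e h.1 (rel_flatten h.2) h'.1 (rel_flatten h'.2)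
      rw [ih h.2 h'.2 e']

theorem sum_map_through {l : List (List α)} (h : ∀ τ ∈ l, T.Dom K k k τ) :
    (l.map (T.through K k k)).sum = (T.wt k l.flatten k : WithBot D) := by
  induction l with
  | nil => simp [T.wt_nil]
  | cons τ l ih =>
    rw [List.forall_mem_cons] at h
    rw [List.map_cons, List.sum_cons, ih h.2, through_of_dom h.1, List.flatten_cons,
      T.wt_append h.1.2.1 (rel_flatten h.2), WithBot.coe_add]

theorem isDecomposition_through {l : List (List α)} :
    IsDecomposition (T.through K k k) w l ↔ w = l.flatten ∧ ∀ τ ∈ l, T.Dom K k k τ := by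
  simp only [IsDecomposition, through_ne_bot]

theorem iterSum_through (hk : k ∉ K) {l : List (List α)} (h : ∀ τ ∈ l, T.Dom K k k τ) :
    iterSum (T.through K k k) l.flatten = (T.wt k l.flatten k : WithBot D) := by
  rw [iterSum_eq_sum (isDecomposition_through.2 ⟨rfl, h⟩), sum_map_through h]
  intro l' hl'
  rw [isDecomposition_through] at hl'
  exact flatten_injective hk hl'.2 h hl'.1.symm

/-- The last visit to `k` fixes the cut (`last_unique`), and the earlier visits fix the loops. -/
theorem through_insert_loops (hk : k ∉ K) :
    T.through (insert k K) k j = splitSum (iterSum (T.through K k k)) (T.through K k j) := by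
  funext w
  have split : ∀ p, IsSplit (iterSum (T.through K k k)) (T.through K k j) w p →
      ∃ l : List (List α), (∀ τ ∈ l, T.Dom K k k τ) ∧ p.1 = l.flatten ∧ T.Dom K k j p.2 ∧
        w = p.1 ++ p.2 := by
    rintro p ⟨e, h1, h2⟩
    obtain ⟨l, hl⟩ := exists_isDecomposition h1
    rw [isDecomposition_through] at hl
    exact ⟨l, hl.2, hl.1, through_ne_bot.1 h2, e⟩
  by_cases h : T.Dom (insert k K) k j w
  · obtain ⟨l, v, e, hl, hv⟩ := h.exists_loops
    rw [through_of_dom h, splitSum_eq_add (p := (l.flatten, v)), iterSum_through hk hl,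
      through_of_dom hv, e, T.wt_append (rel_flatten hl) hv.2.1, WithBot.coe_add]
    · exact ⟨e, by simp [iterSum_through hk hl], through_ne_bot.2 hv⟩
    · intro p hp
      obtain ⟨l', hl', e1, hv', e'⟩ := split p hp
      obtain ⟨h1, h2⟩ := last_unique hk (e'.symm.trans e) (e1 ▸ rel_flatten hl') hv'
        (rel_flatten hl) hv
      exact Prod.ext h1 h2
  · rw [through_of_not_dom h, splitSum_eq_bot]
    intro p hp
    obtain ⟨l, hl, e1, hv, rfl⟩ := split p hp
    rw [e1] at h
    exact h (dom_flatten_append hl hv)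

/-- The priority in the choice is harmless: a path within `K` never visits `k` in between, so there
the split sum is undefined. -/
theorem through_insert (hk : k ∉ K) : T.through (insert k K) i j =
    choice (T.through K i j) (splitSum (T.through K i k) (T.through (insert k K) k j)) := by
  funext w
  by_cases h0 : T.Dom K i j w
  · rw [choice_of_ne_bot (through_ne_bot.2 h0), through_of_dom h0,
      through_of_dom (h0.mono (Set.subset_insert _ _))]
  rw [choice_of_eq_bot (through_of_not_dom h0)]
  by_cases h : T.Dom (insert k K) i j w
  · obtain ⟨u, v, rfl, hu, hv⟩ := h.exists_first h0
    rw [through_of_dom h, splitSum_eq_add (p := (u, v)), through_of_dom hu, through_of_dom hv,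
      T.wt_append hu.2.1 hv.2.1, WithBot.coe_add]
    · exact ⟨rfl, through_ne_bot.2 hu, through_ne_bot.2 hv⟩
    · rintro p ⟨e, h1, h2⟩
      rw [through_ne_bot] at h1 h2
      obtain ⟨h1, h2⟩ := first_unique hk e.symm h1 h2.2.1 hu hv.2.1
      exact Prod.ext h1 h2
  · rw [through_of_not_dom h, splitSum_eq_bot]
    rintro p ⟨rfl, h1, h2⟩
    rw [through_ne_bot] at h1 h2
    exact h ((h1.mono (Set.subset_insert _ _)).append h2 (Set.mem_insert _ _))

/-- Every proper cut of a path has a middle state, so only one-letter words remain. -/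
theorem expressible_through_empty [Finite α] (i j : S) :
    Expressible (T.through ∅ i j) := by
  classical
  refine .of_pieces (fun a : α => if T.Rel i [a] j then const {[a]} (T.wt i [a] j) else fun _ => ⊥)
    (fun a => ?_) (fun a σ => ?_) fun σ hσ => ?_
  · split_ifs
    · exact .const _ (isRegular_of_finite (Set.finite_singleton _)) _
    · exact .bot
  · split_ifs with ha
    · intro hσ
      obtain rfl := const_singleton_ne_bot.1 hσ
      rw [const_singleton_self, through_of_dom]
      refine ⟨by simp, ha, fun u v k e hu hv _ _ => ?_⟩
      have := congrArg List.length e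
      have := List.length_pos_of_ne_nil hu
      have := List.length_pos_of_ne_nil hv
      simp at *
      omega
    · simp
  · rw [through_ne_bot] at hσ
    match σ, hσ with
    | [], hσ => exact absurd rfl hσ.1
    | [a], hσ =>
      refine ⟨a, ?_⟩
      rw [if_pos hσ.2.1, const_singleton_ne_bot]
    | a :: b :: t, hσ =>
      obtain ⟨k, h1, h2⟩ := T.rel_append (u := [a]) (v := b :: t).1 hσ.2.1
      exact (hσ.2.2 [a] (b :: t) k rfl (by simp) (by simp) h1 h2).elim

theorem expressible_through [Finite α] (K : Finset S) (i j : S) :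
    Expressible (T.through (K : Set S) i j) := by
  classical
  induction K using Finset.induction_on generalizing i j with
  | empty => rw [Finset.coe_empty]; exact expressible_through_empty i j
  | insert k K hk ih =>
    rw [Finset.coe_insert]
    have hk' : k ∉ (K : Set S) := hk
    rw [through_insert hk', through_insert_loops hk']
    exact .choice (ih _ _) (.splitSum (ih _ _) (.splitSum (.iterSum (ih _ _)) (ih _ _)))

/-- A cost function is expressible if its value on every nonempty word in its domain is the weight
of a path, followed by a constant that depends only on the endpoints of the path, and its value is
determined in this way by any path between selected endpoints. -/
theorem expressible_of_paths [Finite α] [Finite S] (T : PathSystem α D S) {f : CostFn α D}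
    (I : Set (S × S)) (d : S × S → D)
    (hval : ∀ p ∈ I, ∀ σ, T.Rel p.1 σ p.2 → f σ = ((T.wt p.1 σ p.2 + d p : D) : WithBot D))
    (hdom : ∀ σ, f σ ≠ ⊥ → ∃ p ∈ I, T.Rel p.1 σ p.2) : Expressible f := by
  have := Fintype.ofFinite S
  have hnil : (({[]} : Language α)).IsRegular := isRegular_of_finite (Set.finite_singleton _)
  obtain ⟨g, hg, hg0, hg1⟩ : ∃ g : CostFn α D, Expressible g ∧ g [] = f [] ∧
      ∀ σ, g σ ≠ ⊥ → σ = [] := by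
    cases f [] with
    | bot => exact ⟨_, .bot, rfl, by simp⟩
    | coe c =>
      exact ⟨_, .const _ hnil c, const_singleton_self _ _, fun _ => const_singleton_ne_bot.1⟩
  -- The language `{[]}` forces the cut to the end of `σ`, so the constant is added after the
  -- weight.
  have hpiece (p : S × S) (σ : List α) (hσ : T.Dom Set.univ p.1 p.2 σ) :
      splitSum (T.through Set.univ p.1 p.2) (const {[]} (d p)) σ =
        ((T.wt p.1 σ p.2 + d p : D) : WithBot D) := by
    rw [splitSum_eq_add (p := (σ, [])), through_of_dom hσ, const_singleton_self, WithBot.coe_add]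
    · exact ⟨by simp, through_ne_bot.2 hσ, const_singleton_ne_bot.2 rfl⟩
    · rintro ⟨u, v⟩ ⟨e, _, h2⟩
      obtain rfl : v = [] := const_singleton_ne_bot.1 h2
      simpa using e.symm
  -- `none` indexes the piece for the empty word, where `through` is undefined.
  refine .of_pieces (ι := Option I) (fun o => o.elim g
    fun p => splitSum (T.through Set.univ p.1.1 p.1.2) (const {[]} (d p))) ?_ ?_ ?_
  · rintro (_ | p)
    · exact hg
    · have := expressible_through (T := T) Finset.univ p.1.1 p.1.2
      rw [Finset.coe_univ] at this
      exact .splitSum this (.const _ hnil _)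
  · rintro (_ | p) σ hσ <;> dsimp only [Option.elim] at hσ ⊢
    · rw [hg1 σ hσ, hg0]
    · by_cases h : T.Dom Set.univ p.1.1 p.1.2 σ
      · rw [hpiece _ _ h, hval _ p.2 _ h.2.1]
      · refine absurd (splitSum_eq_bot ?_) hσ
        rintro ⟨u, v⟩ ⟨e, h1, h2⟩
        obtain rfl : v = [] := const_singleton_ne_bot.1 h2
        rw [List.append_nil] at e
        exact h (e ▸ through_ne_bot.1 h1)
  · intro σ hσ
    by_cases e : σ = []
    · subst e
      exact ⟨none, by rwa [Option.elim, hg0]⟩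
    · obtain ⟨p, hp, hr⟩ := hdom σ hσ
      refine ⟨some ⟨p, hp⟩, ?_⟩
      rw [Option.elim, hpiece p σ ⟨e, hr, fun _ _ _ _ _ _ _ _ => Set.mem_univ _⟩]
      exact WithBot.coe_ne_bot

end PathSystem

/-! ### Forward and backward determinism combined -/

/-- A weighted automaton that combines a left-to-right deterministic component `Q` with a component
`P` that is deterministic from right to left. -/
structure BideterministicWeights (α D Q P : Type*) where
  /-- transitions of the forward component -/
  δ : Q → α → Q
  /-- transitions of the backward component -/
  β : Q → α → P → P
  /-- weights of transitions -/
  c : Q → α → P → D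

namespace BideterministicWeights

variable {α D Q P : Type*} (A : BideterministicWeights α D Q P)

/-- The backward state before reading a word, given the one after it. -/
def back : Q → List α → P → P
  | _, [], p => p
  | q, a :: w, p => A.β q a (back (A.δ q a) w p)

theorem back_append (q : Q) (u v : List α) (p : P) :
    A.back q (u ++ v) p = A.back q u (A.back (u.foldl A.δ q) v p) := by
  induction u generalizing q with
  | nil => rfl
  | cons a u ih => simp [back, ih]

variable [AddMonoid D]

/-- The weight of a word, given the forward state before it and the backward state after it. -/
def weight : Q → List α → P → D
  | _, [], _ => 0
  | q, a :: w, p => A.c q a (A.back (A.δ q a) w p) + weight (A.δ q a) w p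

theorem weight_append (q : Q) (u v : List α) (p : P) :
    A.weight q (u ++ v) p =
      A.weight q u (A.back (u.foldl A.δ q) v p) + A.weight (u.foldl A.δ q) v p := by
  induction u generalizing q with
  | nil => simp [weight]
  | cons a u ih => simp [weight, ih, back_append, add_assoc]

/-- The paths of the product of the two components. -/
def paths : PathSystem α D (Q × P) where
  Rel i w j := w.foldl A.δ i.1 = j.1 ∧ i.2 = A.back i.1 w j.2
  wt i w j := A.weight i.1 w j.2
  rel_nil := by simp [back, Prod.ext_iff]
  rel_append := by
    rintro ⟨q, p⟩ ⟨q', p'⟩ u v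
    simp [back_append, and_comm]
  mid_unique := by
    rintro ⟨q, p⟩ ⟨q', p'⟩ u v ⟨r, s⟩ ⟨r', s'⟩ ⟨h1, -⟩ ⟨-, h2⟩ ⟨h3, -⟩ ⟨-, h4⟩
    dsimp only at *
    subst h1 h2 h3 h4
    rfl
  wt_nil _ := rfl
  wt_append := by
    rintro ⟨q, p⟩ ⟨q', p'⟩ u v ⟨r, s⟩ ⟨h1, -⟩ ⟨-, h2⟩
    dsimp only at *
    subst h1 h2
    exact A.weight_append q u v p'

theorem expressible [Finite α] [Finite Q] [Finite P] (q₀ : Q) (F : Set Q) (ν : F → P) (e : F → D)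
    {f : CostFn α D}
    (hbot : ∀ σ, σ.foldl A.δ q₀ ∉ F → f σ = ⊥)
    (hval : ∀ σ (h : σ.foldl A.δ q₀ ∈ F),
      f σ = ((A.weight q₀ σ (ν ⟨_, h⟩) + e ⟨_, h⟩ : D) : WithBot D)) : Expressible f := by
  classical
  -- The backward component of the left endpoint is left free, since it depends on the word.
  refine A.paths.expressible_of_paths
    {p | p.1.1 = q₀ ∧ ∃ h : p.2.1 ∈ F, p.2.2 = ν ⟨_, h⟩}
    (fun p => if h : p.2.1 ∈ F then e ⟨_, h⟩ else 0) ?_ ?_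
  · rintro ⟨⟨q, p⟩, ⟨q', p'⟩⟩ ⟨rfl, h, hp⟩ σ ⟨h1, -⟩
    change σ.foldl A.δ q = q' at h1
    subst h1
    change f σ = ((A.weight q σ p' + dite _ _ _ : D) : WithBot D)
    rw [hval σ h, dif_pos h, show p' = _ from hp]
  · intro σ hσ
    have h : σ.foldl A.δ q₀ ∈ F := by
      by_contra hn
      exact hσ (hbot σ hn)
    exact ⟨((q₀, A.back q₀ σ (ν ⟨_, h⟩)), (_, ν ⟨_, h⟩)), ⟨rfl, h, rfl⟩, rfl, rfl⟩

end BideterministicWeights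

/-! ### Additive automata: tracing one register -/

namespace ACRA

variable {α D Q V : Type*} [AddMonoid D] (M : ACRA α D Q V)

/-- The backward component of an additive automaton follows the register that flows into the
output. -/
def weights : BideterministicWeights α D Q V where
  δ := M.δ
  β q a u := (M.μ q a u).1
  c q a u := (M.μ q a u).2

theorem foldl_step_fst (γ : Q × (V → D)) (σ : List α) :
    (σ.foldl M.step γ).1 = σ.foldl M.δ γ.1 := by
  induction σ generalizing γ with
  | nil => rfl
  | cons a σ ih => simp [ih, step]

theorem foldl_step_snd (γ : Q × (V → D)) (σ : List α) (u : V) :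
    (σ.foldl M.step γ).2 u = γ.2 (M.weights.back γ.1 σ u) + M.weights.weight γ.1 σ u := by
  induction σ generalizing γ with
  | nil => simp [BideterministicWeights.back, BideterministicWeights.weight]
  | cons a σ ih =>
    rw [List.foldl_cons, ih]
    simp [BideterministicWeights.back, BideterministicWeights.weight, step, weights, add_assoc]

theorem expressible_eval [Finite α] [Finite Q] [Finite V] : Expressible M.eval := by
  refine M.weights.expressible M.q₀ M.F (fun q => (M.ν q).1) (fun q => (M.ν q).2) ?_ ?_
  · intro σ h
    refine dif_neg ?_
    rwa [run, foldl_step_fst]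
  · intro σ h
    have hfst : (M.run σ).1 = σ.foldl M.δ M.q₀ := M.foldl_step_fst _ σ
    have h' : (M.run σ).1 ∈ M.F := hfst ▸ h
    have hq : (⟨_, h'⟩ : M.F) = ⟨_, h⟩ := Subtype.ext hfst
    rw [eval, dif_pos h', hq, run, foldl_step_snd, zero_add]

end ACRA

/-! ### Copyless automata: tracing a set of registers -/

section Expressions

variable {V D : Type*}

/-- The sum of the constants that occur in an expression. -/
def constSum [AddMonoid D] (e : List (V ⊕ D)) : D := exprVal (fun _ => 0) e

theorem exprVal_eq [AddCommMonoid D] (val : V → D) (e : List (V ⊕ D)) :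
    exprVal val e = ((regs e).map val).sum + constSum e := by
  induction e with
  | nil => simp [exprVal, regs, constSum]
  | cons x e ih =>
    simp only [exprVal, regs, constSum, List.map_cons, List.sum_cons] at ih ⊢
    rw [ih]
    cases x <;> simp [List.filterMap_cons, add_assoc, add_left_comm]

variable [DecidableEq V]

theorem exprVal_of_copyless [AddCommMonoid D] (val : V → D) {e : List (V ⊕ D)}
    (he : CopylessExpr e) :
    exprVal val e = ∑ v ∈ (regs e).toFinset, val v + constSum e := by
  rw [exprVal_eq, List.sum_toFinset val he]

/-- Distinct right-hand sides share no register, so the union counts each register once. -/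
theorem sum_exprVal_of_copyless [AddCommMonoid D] (val : V → D) {f : V → List (V ⊕ D)}
    (hf : CopylessUpdate f) (s : Finset V) :
    ∑ u ∈ s, exprVal val (f u) =
      ∑ v ∈ s.biUnion (fun u => (regs (f u)).toFinset), val v + ∑ u ∈ s, constSum (f u) := by
  rw [Finset.sum_biUnion, ← Finset.sum_add_distrib]
  · exact Finset.sum_congr rfl fun u _ => exprVal_of_copyless val (hf.1 u)
  · intro u _ w _ huw
    rw [Function.onFun, Finset.disjoint_left]
    simpa using fun v hv => hf.2 u v w huw hv

end Expressions

namespace CCRA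

variable {α D Q V : Type*} [AddCommMonoid D] (M : CCRA α D Q V)

/-- The backward component of a copyless automaton follows the set of registers that flow into the
output. -/
def weights [DecidableEq V] : BideterministicWeights α D Q (Finset V) where
  δ := M.δ
  β q a s := s.biUnion fun u => (regs (M.μ q a u)).toFinset
  c q a s := ∑ u ∈ s, constSum (M.μ q a u)

theorem foldl_step_fst (γ : Q × (V → D)) (σ : List α) :
    (σ.foldl M.step γ).1 = σ.foldl M.δ γ.1 := by
  induction σ generalizing γ with
  | nil => rfl
  | cons a σ ih => simp [ih, step]

theorem sum_foldl_step [DecidableEq V] (γ : Q × (V → D)) (σ : List α) (s : Finset V) :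
    ∑ u ∈ s, (σ.foldl M.step γ).2 u =
      ∑ v ∈ M.weights.back γ.1 σ s, γ.2 v + M.weights.weight γ.1 σ s := by
  induction σ generalizing γ with
  | nil => simp [BideterministicWeights.back, BideterministicWeights.weight]
  | cons a σ ih =>
    rw [List.foldl_cons, ih, step, sum_exprVal_of_copyless _ (M.μ_copyless _ _), add_assoc]
    rfl

theorem expressible_eval [Finite α] [Finite Q] [Finite V] : Expressible M.eval := by
  classical
  refine M.weights.expressible M.q₀ M.F (fun q => (regs (M.ν q)).toFinset)
    (fun q => constSum (M.ν q)) ?_ ?_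
  · intro σ h
    refine dif_neg ?_
    rwa [run, foldl_step_fst]
  · intro σ h
    have hfst : (M.run σ).1 = σ.foldl M.δ M.q₀ := M.foldl_step_fst _ σ
    have h' : (M.run σ).1 ∈ M.F := hfst ▸ h
    have hq : (⟨_, h'⟩ : M.F) = ⟨_, h⟩ := Subtype.ext hfst
    rw [eval, dif_pos h', hq, exprVal_of_copyless _ (M.ν_copyless _), run, sum_foldl_step]
    -- The traced initial registers all hold `0`.
    simp only [Finset.sum_const_zero, zero_add]

end CCRA

end RegCost

theorem mainTheorem3 {α D : Type*} [Finite α] [AddCommMonoid D] :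
    (∀ f : RegCost.CostFn α D, RegCost.IsRegular f → RegCost.Expressible f) ∧
    (∀ f : RegCost.CostFn α D, RegCost.IsAdditiveRegular f → RegCost.Expressible f) := by
  constructor
  · rintro _ ⟨Q, V, _, _, M, rfl⟩
    exact M.expressible_eval
  · rintro _ ⟨Q, V, _, _, M, rfl⟩
    exact M.expressible_eval
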